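/- Let $p \in [1,\infty]$ and equip $\mathbb{R}^4$ with the $p$-norm $\|x\|_p = (\sum_{i=1}^4 |x_i|^p)^{1/p}$ for $p < \infty$ and $\|x\|_\infty = \max_i |x_i|$ for $p=\infty$. For a bounded set $X \subset \mathbb{R}^4$ let $d_p(X) = \sup\{\|x-y\|_p : x, y \in X\}$ (with $d_p(\emptyset)=0$), and let $b_{C_{4,p}}(X)$ be the smallest number $k$ for which there are subsets $X_1,\dots,X_k$ of $X$ with $X = \bigcup_{i=1}^k X_i$ and $d_p(X_i) < d_p(X)$ for all $i$ (and $\infty$ if there is no such $k$). Then, for every $p \in [1,\infty]$ and every bounded set $X \subset \mathbb{R}^4$ with at least two points, $$b_{C_{4,p}}(X) \le 2^4 .$$ That is, $X$ is the union of at most $16$ subsets, each of strictly smaller $\ell_p$-diameter. -/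

import Mathlib

/-- `X` is the union of `k` subsets, each of diameter strictly smaller than that of `X`.
For bounded `X`, `Metric.diam` is the supremum of the distances between two points of the set. -/
def DividesInto {α : Type*} [MetricSpace α] (X : Set α) (k : ℕ) : Prop :=
  ∃ Y : Fin k → Set α, (X = ⋃ i, Y i) ∧ (∀ i, Metric.diam (Y i) < Metric.diam X)

/-- The Borsuk number `b(X)`: the smallest number of subsets of strictly smaller diameter
into which `X` can be divided. Its value is `⊤` if no such finite number exists. -/
noncomputable def borsukNumber {α : Type*} [MetricSpace α] (X : Set α) : ℕ∞ :=
  ⨅ (k : ℕ) (_ : DividesInto X k), (k : ℕ∞)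

theorem borsukNumber_le_iff {α : Type*} [MetricSpace α] (X : Set α) (n : ℕ) :
    borsukNumber X ≤ (n : ℕ∞) ↔ ∃ k ≤ n, DividesInto X k := by
  constructor
  · intro h
    by_contra! hc
    have h1 : ((n + 1 : ℕ) : ℕ∞) ≤ borsukNumber X := by
      refine le_iInf₂ fun k hk => ?_
      have hnk : n < k := by
        by_contra hle
        exact hc k (not_lt.mp hle) hk
      exact_mod_cast hnk
    have h2 : ((n + 1 : ℕ) : ℕ∞) ≤ (n : ℕ∞) := h1.trans h
    have h3 : n + 1 ≤ n := by exact_mod_cast h2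
    omega
  · rintro ⟨k, hkn, hk⟩
    exact (iInf₂_le k hk).trans (by exact_mod_cast hkn)

/-!
Let `r` be half the diameter of `X`, which may be assumed compact. The idea is to choose four
linear coordinates in which every coordinate difference is at most the `p`-distance, while the
`p`-distance is at most the Euclidean distance. Then `X` lies in a box of side `2 r`, and cutting
the box into its `16` orthants of side `r` almost works: an orthant has Euclidean diameter `2 r`,
and the only pairs of its points which can be at `p`-distance `2 r` are pairs of opposite vertices
(`opposite_vertices_of_sq_le`). For `p ≥ 2` the standard coordinates have this property, for
`p ≤ 2` the scaled Hadamard coordinates `4 ^ (1 / p - 1) • H z` do, by comparison of power means.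

Two observations remove the borderline pairs.

* It is enough that *one* orthant contains no diametral pair (`dividesInto_of_orthant`). By
  compactness this orthant may then be slightly enlarged. The rest is sliced off by hierarchical
  cuts whose shifts increase geometrically, so that the strict gain in the first coordinate in
  which a point leaves the enlarged orthant outweighs the loss in the earlier coordinates.
* Not all `16` orthants can contain a diametral pair (which must consist of opposite vertices).
  For `p > 2` opposite vertices are too close. For `p = 2` two opposite orthants already contradict
  each other (`false_of_opposite_orthants`). For `p < 2` only differences with an odd number of
  negative Hadamard coordinates are diametral, so the positive orthant contributes a vertex with
  exactly three nonzero coordinates, and this vertex is too far from one of the two points found in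
  the orthant that is opposite in exactly these coordinates (`false_of_three_nonzero`). There the
  distance is estimated from below by the scaled `ℓ¹` norm, whose unit ball in Hadamard coordinates
  is a 16-cell.
-/

/-! ### Subsets of smaller diameter -/

theorem dividesInto_of_fibers {α ι : Type*} [MetricSpace α] [Fintype ι] {X : Set α} (f : α → ι)
    (hf : ∀ c, Metric.diam (X ∩ f ⁻¹' {c}) < Metric.diam X) :
    DividesInto X (Fintype.card ι) := by
  refine ⟨fun i => X ∩ f ⁻¹' {(Fintype.equivFin ι).symm i}, ?_, fun i => hf _⟩
  ext x
  simp only [Set.mem_iUnion, Set.mem_inter_iff, Set.mem_preimage, Set.mem_singleton_iff]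
  exact ⟨fun hx => ⟨Fintype.equivFin ι (f x), hx, by simp⟩, fun ⟨_, hx, _⟩ => hx⟩

theorem DividesInto.of_closure {α : Type*} [MetricSpace α] {X : Set α} {k : ℕ}
    (hX : Bornology.IsBounded X) (h : DividesInto (closure X) k) : DividesInto X k := by
  obtain ⟨Y, hY, hd⟩ := h
  refine ⟨fun i => X ∩ Y i, ?_, fun i => ?_⟩
  · rw [← Set.inter_iUnion, ← hY, Set.inter_eq_left.2 subset_closure]
  · have hsub : Y i ⊆ closure X := hY ▸ Set.subset_iUnion Y i
    rw [← Metric.diam_closure X]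
    exact (Metric.diam_mono Set.inter_subset_right (hX.closure.subset hsub)).trans_lt (hd i)

theorem IsCompact.diam_lt_of_forall_dist_lt {α : Type*} [MetricSpace α] {K : Set α}
    (hK : IsCompact K) {d : ℝ} (hd : 0 < d) (h : ∀ x ∈ K, ∀ y ∈ K, dist x y < d) :
    Metric.diam K < d := by
  rcases K.eq_empty_or_nonempty with rfl | hne
  · simpa using hd
  obtain ⟨⟨a, b⟩, hab, hmax⟩ := (hK.prod hK).exists_isMaxOn (hne.prod hne)
    (continuous_dist (α := α)).continuousOn
  refine lt_of_le_of_lt (Metric.diam_le_of_forall_dist_le dist_nonneg fun x hx y hy => ?_)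
    (h a hab.1 b hab.2)
  exact hmax (Set.mk_mem_prod hx hy)

/-! ### Hierarchical cuts around a good orthant -/

open Classical in
/-- The cell of a point with coordinates `u` under hierarchical cuts: the `j`-th coordinate is cut
at `-η j` as long as the earlier coordinates stay on the upper side of their cuts, and at `0` from
then on. The cell is recorded by the four sides, as truth values. -/
noncomputable def shiftedCell (η u : Fin 4 → ℝ) : Fin 4 → Prop :=
  fun j => if ∀ k < j, -η k ≤ u k then -η j ≤ u j else 0 ≤ u j

/-- Points of one cell leave the upper sides of the cuts at the same coordinate. -/
theorem shiftedCell_prefix {η u v : Fin 4 → ℝ} (h : shiftedCell η u = shiftedCell η v) :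
    ∀ j : Fin 4, (∀ k < j, -η k ≤ u k) → ∀ k < j, -η k ≤ v k := by
  intro j
  induction j using WellFoundedLT.induction with
  | ind j ih =>
    intro hu k hk
    have hu' : ∀ l < k, -η l ≤ u l := fun l hl => hu l (hl.trans hk)
    have := congrFun h k
    simp only [shiftedCell, if_pos hu', if_pos (ih k hk hu'), eq_iff_iff] at this
    exact this.1 (hu k hk)

theorem shiftedCell_upper {η u v : Fin 4 → ℝ} (h : shiftedCell η u = shiftedCell η v)
    (hu : ∀ i, -η i ≤ u i) (i : Fin 4) : -η i ≤ v i := by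
  have hv := shiftedCell_prefix h i fun k _ => hu k
  have := congrFun h i
  simp only [shiftedCell, if_pos hv, if_pos fun k (_ : k < i) => hu k, eq_iff_iff] at this
  exact this.1 (hu i)

/-- Two points of the box `[-r, r]⁴` in one cell of the hierarchical cuts, other than the enlarged
positive orthant, are at Euclidean distance uniformly smaller than `2 r`. -/
theorem sum_sq_sub_le_of_shiftedCell_eq {r θ : ℝ} (hθ : 0 < θ) (hθr : 125 * θ ≤ r)
    {u v : Fin 4 → ℝ} (hu : ∀ i, |u i| ≤ r) (hv : ∀ i, |v i| ≤ r)
    (h : shiftedCell (fun j => θ * 5 ^ (j : ℕ)) u = shiftedCell (fun j => θ * 5 ^ (j : ℕ)) v)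
    (hneg : ∃ i : Fin 4, u i < -(θ * 5 ^ (i : ℕ))) :
    ∑ i, (u i - v i) ^ 2 ≤ 4 * r ^ 2 - r * θ := by
  classical
  obtain ⟨i, hi, hmin⟩ := exists_minimal_of_wellFoundedLT
    (fun i : Fin 4 => u i < -(θ * 5 ^ (i : ℕ))) hneg
  have hui : ∀ k < i, -(θ * 5 ^ (k : ℕ)) ≤ u k := fun k hk => by
    by_contra hc
    exact absurd (hmin (not_le.1 hc) hk.le) (not_le.2 hk)
  have hvi := shiftedCell_prefix h i hui
  have hr : 0 < r := by linarith
  have hη : ∀ k : Fin 4, 0 < θ * 5 ^ (k : ℕ) ∧ θ * 5 ^ (k : ℕ) ≤ r := by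
    intro k
    refine ⟨by positivity, ?_⟩
    fin_cases k <;> norm_num <;> linarith
  have hlt : ∀ k < i, (u k - v k) ^ 2 ≤ r ^ 2 + 3 * r * (θ * 5 ^ (k : ℕ)) := by
    intro k hk
    have h1 := abs_le.1 (hu k)
    have h2 := abs_le.1 (hv k)
    have h3 := hui k hk
    have h4 := hvi k hk
    have h5 := hη k
    have : |u k - v k| ≤ r + θ * 5 ^ (k : ℕ) := abs_le.2 ⟨by linarith, by linarith⟩
    have := pow_le_pow_left₀ (abs_nonneg _) this 2
    rw [sq_abs] at this
    nlinarith
  have heq : (u i - v i) ^ 2 ≤ r ^ 2 - r * (θ * 5 ^ (i : ℕ)) := by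
    have h1 := abs_le.1 (hu i)
    have h2 := abs_le.1 (hv i)
    have h5 := hη i
    have h3 : v i < -(θ * 5 ^ (i : ℕ)) := by
      have := congrFun h i
      simp only [shiftedCell, if_pos hui, if_pos hvi, eq_iff_iff] at this
      by_contra hc
      exact absurd (this.2 (not_lt.1 hc)) (not_le.2 hi)
    have : |u i - v i| ≤ r - θ * 5 ^ (i : ℕ) := abs_le.2 ⟨by linarith, by linarith⟩
    have := pow_le_pow_left₀ (abs_nonneg _) this 2
    rw [sq_abs] at this
    nlinarith
  have hgt : ∀ k > i, (u k - v k) ^ 2 ≤ r ^ 2 := by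
    intro k hk
    have h1 := abs_le.1 (hu k)
    have h2 := abs_le.1 (hv k)
    have hu' : ¬ ∀ l < k, -(θ * 5 ^ (l : ℕ)) ≤ u l := fun hc => absurd (hc i hk) (not_le.2 hi)
    have hv' : ¬ ∀ l < k, -(θ * 5 ^ (l : ℕ)) ≤ v l :=
      fun hc => hu' (shiftedCell_prefix h.symm k hc)
    have := congrFun h k
    simp only [shiftedCell, if_neg hu', if_neg hv', eq_iff_iff] at this
    have : |u k - v k| ≤ r := by
      by_cases hc : 0 ≤ u k
      · have := this.1 hc
        exact abs_le.2 ⟨by linarith, by linarith⟩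
      · have := mt this.2 hc
        exact abs_le.2 ⟨by linarith, by linarith⟩
    have := pow_le_pow_left₀ (abs_nonneg _) this 2
    rwa [sq_abs] at this
  have hrθ : 0 < r * θ := by positivity
  rw [Fin.sum_univ_four]
  -- The gain `5 ^ i` in coordinate `i` exceeds the loss `3 * (1 + 5 + ⋯ + 5 ^ (i - 1))` by
  -- at least `1`.
  obtain rfl | rfl | rfl | rfl : i = 0 ∨ i = 1 ∨ i = 2 ∨ i = 3 := by fin_cases i <;> simp
  · have h1 := hgt 1 (by decide)
    have h2 := hgt 2 (by decide)
    have h3 := hgt 3 (by decide)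
    norm_num at heq h1 h2 h3
    linarith
  · have h0 := hlt 0 (by decide)
    have h2 := hgt 2 (by decide)
    have h3 := hgt 3 (by decide)
    norm_num at heq h0 h2 h3
    linarith
  · have h0 := hlt 0 (by decide)
    have h1 := hlt 1 (by decide)
    have h3 := hgt 3 (by decide)
    norm_num at heq h0 h1 h3
    linarith
  · have h0 := hlt 0 (by decide)
    have h1 := hlt 1 (by decide)
    have h2 := hlt 2 (by decide)
    norm_num at heq h0 h1 h2
    linarith

/-- If a compact set in the box has no diametral pair in the closed positive orthant, then an
enlargement of that orthant still carries a piece of smaller diameter, and hierarchical cuts slice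
the rest into `15` smaller pieces. -/
theorem dividesInto_of_orthant {α : Type*} [MetricSpace α] {X : Set α} (hX : IsCompact X)
    {r : ℝ} (hr : 0 < r) (hd : Metric.diam X = 2 * r) (L : Fin 4 → α → ℝ)
    (hLc : ∀ i, Continuous (L i)) (hbox : ∀ x ∈ X, ∀ i, |L i x| ≤ r)
    (hdist : ∀ x y, dist x y ^ 2 ≤ ∑ i, (L i x - L i y) ^ 2)
    (hgood : ∀ x ∈ X, ∀ y ∈ X, (∀ i, 0 ≤ L i x) → (∀ i, 0 ≤ L i y) → dist x y ≠ 2 * r) :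
    DividesInto X 16 := by
  classical
  -- Diametral pairs stay uniformly away from the positive orthant.
  obtain ⟨m, hm, hfar⟩ : ∃ m > 0, ∀ x ∈ X, ∀ y ∈ X, (∀ i, -m ≤ L i x) → (∀ i, -m ≤ L i y) →
      dist x y < 2 * r := by
    have hPc : IsCompact ((X ×ˢ X) ∩ {q : α × α | 2 * r ≤ dist q.1 q.2}) :=
      (hX.prod hX).inter_right (isClosed_le continuous_const continuous_dist)
    let g : α × α → ℝ := fun q => (Finset.univ.inf' Finset.univ_nonempty fun i => L i q.1) ⊓
      (Finset.univ.inf' Finset.univ_nonempty fun i => L i q.2)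
    have hg : Continuous g := by
      refine Continuous.inf ?_ ?_
      · exact Continuous.finset_inf'_apply _ fun i _ => (hLc i).comp continuous_fst
      · exact Continuous.finset_inf'_apply _ fun i _ => (hLc i).comp continuous_snd
    have hgle : ∀ (t : ℝ) (q : α × α), t ≤ g q ↔ (∀ i, t ≤ L i q.1) ∧ ∀ i, t ≤ L i q.2 := by
      intro t q
      simp [g]
    rcases Set.eq_empty_or_nonempty ((X ×ˢ X) ∩ {q : α × α | 2 * r ≤ dist q.1 q.2}) with he | hne
    · refine ⟨1, one_pos, fun x hx y hy _ _ => ?_⟩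
      by_contra hc
      exact Set.eq_empty_iff_forall_notMem.1 he (x, y) ⟨⟨hx, hy⟩, not_lt.1 hc⟩
    · obtain ⟨⟨a, b⟩, ⟨⟨ha, hb⟩, hab⟩, hmax⟩ := hPc.exists_isMaxOn hne hg.continuousOn
      have hneg : g (a, b) < 0 := by
        by_contra hc
        obtain ⟨h1, h2⟩ := (hgle 0 (a, b)).1 (not_lt.1 hc)
        refine hgood a ha b hb h1 h2 (le_antisymm ?_ hab)
        exact hd ▸ Metric.dist_le_diam_of_mem hX.isBounded ha hb
      refine ⟨-g (a, b) / 2, by linarith, fun x hx y hy h1 h2 => ?_⟩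
      by_contra hc
      have h3 : g (x, y) ≤ g (a, b) := hmax ⟨⟨hx, hy⟩, not_lt.1 hc⟩
      have h4 := (hgle _ (x, y)).2 ⟨h1, h2⟩
      linarith
  obtain ⟨θ, hθ, hθr, hθm⟩ : ∃ θ > 0, 125 * θ ≤ r ∧ 125 * θ ≤ m :=
    ⟨min r m / 125, by positivity, by linarith [min_le_left r m], by linarith [min_le_right r m]⟩
  have hcard : Fintype.card (Fin 4 → Prop) = 16 := by simp
  rw [← hcard]
  refine dividesInto_of_fibers
    (fun x => shiftedCell (fun j => θ * 5 ^ (j : ℕ)) fun i => L i x) fun c => ?_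
  rw [hd]
  -- Either the cell `c` is sliced off at some coordinate, or it is the enlarged positive orthant.
  by_cases hall : ∃ x ∈ X, shiftedCell (fun j => θ * 5 ^ (j : ℕ)) (fun i => L i x) = c ∧
      ∃ i : Fin 4, L i x < -(θ * 5 ^ (i : ℕ))
  · obtain ⟨z, hz, hzc, hzi⟩ := hall
    have hrθ : 0 < r * θ := by positivity
    have hlt : Real.sqrt (4 * r ^ 2 - r * θ) < 2 * r := by
      rw [Real.sqrt_lt' (by positivity)]
      nlinarith
    refine lt_of_le_of_lt (Metric.diam_le_of_forall_dist_le (Real.sqrt_nonneg _) ?_) hlt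
    rintro x ⟨hx, hxc⟩ y ⟨hy, hyc⟩
    refine Real.le_sqrt_of_sq_le ((hdist x y).trans ?_)
    have hxc' : shiftedCell (fun j => θ * 5 ^ (j : ℕ)) (fun i => L i x) = c := hxc
    have hyc' : shiftedCell (fun j => θ * 5 ^ (j : ℕ)) (fun i => L i y) = c := hyc
    refine sum_sq_sub_le_of_shiftedCell_eq hθ hθr (hbox x hx) (hbox y hy)
      (hxc'.trans hyc'.symm) ?_
    by_contra! hpos
    obtain ⟨i, hi⟩ := hzi
    exact absurd (shiftedCell_upper (hxc'.trans hzc.symm) hpos i) (not_le.2 hi)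
  · push Not at hall
    have hle : ∀ i : Fin 4, θ * 5 ^ (i : ℕ) ≤ m := by
      intro k
      fin_cases k <;> norm_num <;> linarith
    refine lt_of_le_of_lt (Metric.diam_mono (t := X ∩ {x | ∀ i, -m ≤ L i x}) ?_
      (hX.isBounded.subset Set.inter_subset_left)) ?_
    · rintro x ⟨hx, hxc⟩
      exact ⟨hx, fun i => (neg_le_neg (hle i)).trans (hall x hx hxc i)⟩
    · refine IsCompact.diam_lt_of_forall_dist_lt (hX.inter_right ?_) (by positivity) ?_
      · simp only [Set.ofPred_forall]
        exact isClosed_iInter fun i => isClosed_le continuous_const (hLc i)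
      · rintro x ⟨hx, hx'⟩ y ⟨hy, hy'⟩
        exact hfar x hx y hy hx' hy'

/-! ### Diametral pairs of opposite vertices -/

theorem IsCompact.exists_center {α : Type*} [MetricSpace α] {X : Set α} (hX : IsCompact X)
    (hne : X.Nonempty) {r : ℝ} (hd : Metric.diam X = 2 * r) {f : α → ℝ} (hf : Continuous f)
    (hlip : ∀ x y, |f x - f y| ≤ dist x y) : ∃ c, ∀ x ∈ X, |f x - c| ≤ r := by
  obtain ⟨a, ha, hmin⟩ := hX.exists_isMinOn hne hf.continuousOn
  obtain ⟨b, hb, hmax⟩ := hX.exists_isMaxOn hne hf.continuousOn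
  have hab := (hlip b a).trans (hd ▸ Metric.dist_le_diam_of_mem hX.isBounded hb ha)
  refine ⟨(f a + f b) / 2, fun x hx => ?_⟩
  have h1 : f a ≤ f x := hmin hx
  have h2 : f x ≤ f b := hmax hx
  have h3 := abs_le.1 hab
  exact abs_le.2 ⟨by linarith, by linarith⟩

/-- A diametral pair inside an orthant cell of side `r` consists of two opposite vertices of it,
since the Euclidean diameter of the cell is also `2 r`. -/
theorem opposite_vertices_of_sq_le {r : ℝ} {u v : Fin 4 → ℝ}
    (hu : ∀ i, 0 ≤ u i ∧ u i ≤ r) (hv : ∀ i, 0 ≤ v i ∧ v i ≤ r)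
    (h : (2 * r) ^ 2 ≤ ∑ i, (u i - v i) ^ 2) (i : Fin 4) :
    (u i = 0 ∧ v i = r) ∨ (u i = r ∧ v i = 0) := by
  have hle : ∀ j ∈ Finset.univ, (u j - v j) ^ 2 ≤ r ^ 2 := fun j _ =>
    sq_le_sq' (by linarith [(hu j).1, (hv j).2]) (by linarith [(hu j).2, (hv j).1])
  have heq : ∑ j, (u j - v j) ^ 2 = ∑ _j : Fin 4, r ^ 2 :=
    le_antisymm (Finset.sum_le_sum hle) (by simp only [Fin.sum_univ_four] at *; linarith)
  have hi := (Finset.sum_eq_sum_iff_of_le hle).1 heq i (Finset.mem_univ i)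
  obtain ⟨h1, h2⟩ := hu i
  obtain ⟨h3, h4⟩ := hv i
  rcases sq_eq_sq_iff_eq_or_eq_neg.1 hi with h5 | h5
  · exact Or.inr ⟨by linarith, by linarith⟩
  · exact Or.inl ⟨by linarith, by linarith⟩

/-- An indivisible compact set contains, in every one of the `16` cells around the center of a
suitable box, a diametral pair of opposite vertices of that cell. -/
theorem exists_opposite_vertices {α : Type*} [MetricSpace α] {X : Set α} (hX : IsCompact X)
    (hne : X.Nonempty) {r : ℝ} (hr : 0 < r) (hd : Metric.diam X = 2 * r) (L : Fin 4 → α → ℝ)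
    (hLc : ∀ i, Continuous (L i)) (hlip : ∀ i x y, |L i x - L i y| ≤ dist x y)
    (hdist : ∀ x y, dist x y ^ 2 ≤ ∑ i, (L i x - L i y) ^ 2) (hX16 : ¬ DividesInto X 16) :
    ∃ c : Fin 4 → ℝ, ∀ σ : Fin 4 → ℝ, (∀ i, σ i = 1 ∨ σ i = -1) →
      ∃ x ∈ X, ∃ y ∈ X, dist x y = 2 * r ∧
        ∀ i, (L i x - c i = 0 ∧ L i y - c i = σ i * r) ∨
          (L i x - c i = σ i * r ∧ L i y - c i = 0) := by
  choose c hc using fun i => hX.exists_center hne hd (hLc i) (hlip i)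
  refine ⟨c, fun σ hσ => ?_⟩
  have hσ2 : ∀ i, σ i ^ 2 = 1 := fun i => by rcases hσ i with h | h <;> simp [h]
  have hbox : ∀ x ∈ X, ∀ i, |σ i * (L i x - c i)| ≤ r := fun x hx i => by
    rcases hσ i with h | h <;> simpa [h, abs_sub_comm] using hc i x hx
  have hdist' : ∀ x y, dist x y ^ 2 ≤
      ∑ i, (σ i * (L i x - c i) - σ i * (L i y - c i)) ^ 2 := fun x y => by
    refine (hdist x y).trans_eq (Finset.sum_congr rfl fun i _ => ?_)
    linear_combination (-(L i x - L i y) ^ 2) * hσ2 i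
  have hpair : ∃ x ∈ X, ∃ y ∈ X, (∀ i, 0 ≤ σ i * (L i x - c i)) ∧
      (∀ i, 0 ≤ σ i * (L i y - c i)) ∧ dist x y = 2 * r := by
    by_contra! hgood
    exact hX16 (dividesInto_of_orthant hX hr hd (fun i x => σ i * (L i x - c i))
      (fun i => continuous_const.mul ((hLc i).sub continuous_const)) hbox hdist' hgood)
  obtain ⟨x, hx, y, hy, hx0, hy0, hxy⟩ := hpair
  refine ⟨x, hx, y, hy, hxy, fun i => ?_⟩
  have key := opposite_vertices_of_sq_le (fun i => ⟨hx0 i, (le_abs_self _).trans (hbox x hx i)⟩)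
    (fun i => ⟨hy0 i, (le_abs_self _).trans (hbox y hy i)⟩) (hxy ▸ hdist' x y) i
  rcases hσ i with h | h
  · simpa [h] using key
  · rw [h] at key ⊢
    rcases key with ⟨h1, h2⟩ | ⟨h1, h2⟩
    · exact Or.inl ⟨by linarith, by linarith⟩
    · exact Or.inr ⟨by linarith, by linarith⟩

/-- Diametral pairs of opposite vertices cannot occur both in the positive and in the negative
orthant if distances are at least the Euclidean ones. -/
theorem false_of_opposite_orthants {α : Type*} [MetricSpace α] {r : ℝ} (hr : 0 < r)
    {L : Fin 4 → α → ℝ} {c : Fin 4 → ℝ} {X : Set α} (hX : ∀ x ∈ X, ∀ y ∈ X, dist x y ≤ 2 * r)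
    (hdist : ∀ x y, ∑ i, (L i x - L i y) ^ 2 ≤ dist x y ^ 2)
    {x y x' y' : α} (hx : x ∈ X) (hy : y ∈ X) (hx' : x' ∈ X) (hy' : y' ∈ X)
    (h : ∀ i, (L i x - c i = 0 ∧ L i y - c i = r) ∨ (L i x - c i = r ∧ L i y - c i = 0))
    (h' : ∀ i, (L i x' - c i = 0 ∧ L i y' - c i = -r) ∨
      (L i x' - c i = -r ∧ L i y' - c i = 0)) : False := by
  have key : ∀ a ∈ X, ∀ b ∈ X, ∑ i, (L i a - L i b) ^ 2 ≤ 4 * r ^ 2 := fun a ha b hb =>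
    (hdist a b).trans ((pow_le_pow_left₀ dist_nonneg (hX a ha b hb) 2).trans_eq (by ring))
  -- Each coordinate contributes `4 r² + r² + r² + 0` to the sum over the four mixed pairs.
  have hsix : ∀ i, (L i x - L i x') ^ 2 + (L i x - L i y') ^ 2 + (L i y - L i x') ^ 2 +
      (L i y - L i y') ^ 2 = 6 * r ^ 2 := by
    intro i
    have e : ∀ a b, L i a - L i b = (L i a - c i) - (L i b - c i) := fun a b => by ring
    simp only [e]
    rcases h i with ⟨h1, h2⟩ | ⟨h1, h2⟩ <;> rcases h' i with ⟨h3, h4⟩ | ⟨h3, h4⟩ <;>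
      rw [h1, h2, h3, h4] <;> ring
  have hsum := Finset.sum_congr rfl fun i (_ : i ∈ Finset.univ) => hsix i
  simp only [Finset.sum_add_distrib, Finset.sum_const, Finset.card_univ, Fintype.card_fin] at hsum
  have h1 := key x hx x' hx'
  have h2 := key x hx y' hy'
  have h3 := key y hy x' hx'
  have h4 := key y hy y' hy'
  have : 0 < r ^ 2 := by positivity
  norm_num at hsum
  linarith

/-- The vertex `v` has exactly three nonzero coordinates, and `x'`, `y'` are opposite vertices of
the cell which is antipodal in these three coordinates. The half-sum of the coordinates, with the
sign of the remaining one reversed, then separates `v` from `x'` or `y'` too far. -/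
theorem false_of_three_nonzero {α : Type*} [MetricSpace α] {r : ℝ} (hr : 0 < r)
    {L : Fin 4 → α → ℝ} {c : Fin 4 → ℝ} {X : Set α} (hX : ∀ x ∈ X, ∀ y ∈ X, dist x y ≤ 2 * r)
    (l : Fin 4)
    (hdist : ∀ x y, |∑ i, (if i = l then -1 else 1) * (L i x - L i y)| ≤ 2 * dist x y)
    {v x' y' : α} (hv : v ∈ X) (hx' : x' ∈ X) (hy' : y' ∈ X)
    (h : ∀ i, L i v - c i = if i = l then 0 else r)
    (h' : ∀ i, (L i x' - c i = 0 ∧ L i y' - c i = (if i = l then 1 else -1) * r) ∨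
      (L i x' - c i = (if i = l then 1 else -1) * r ∧ L i y' - c i = 0)) : False := by
  have h1 := (le_abs_self _).trans ((hdist v x').trans
    (mul_le_mul_of_nonneg_left (hX v hv x' hx') zero_le_two))
  have h2 := (le_abs_self _).trans ((hdist v y').trans
    (mul_le_mul_of_nonneg_left (hX v hv y' hy') zero_le_two))
  have hsum : ∀ i, (if i = l then -1 else 1) * (L i v - L i x') +
      (if i = l then -1 else 1) * (L i v - L i y') = if i = l then r else 3 * r := by
    intro i
    have e : ∀ a b, L i a - L i b = (L i a - c i) - (L i b - c i) := fun a b => by ring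
    simp only [e, h i]
    rcases h' i with ⟨h3, h4⟩ | ⟨h3, h4⟩ <;> rw [h3, h4] <;> split_ifs <;> ring
  have hS := Finset.sum_congr rfl fun i (_ : i ∈ Finset.univ) => hsum i
  rw [Finset.sum_add_distrib] at hS
  have hS' : ∑ i : Fin 4, (if i = l then r else 3 * r) = 10 * r := by
    have e : ∀ i : Fin 4, (if i = l then r else 3 * r) = 3 * r - if i = l then 2 * r else 0 :=
      fun i => by split_ifs <;> ring
    simp only [e, Finset.sum_sub_distrib, Finset.sum_const, Finset.card_univ, Fintype.card_fin,
      Finset.sum_ite_eq', Finset.mem_univ, if_true, nsmul_eq_mul]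
    push_cast
    ring
  linarith

/-- Opposite vertices of a cube whose difference has an odd number of negative coordinates: one of
them has exactly three nonzero coordinates. -/
theorem exists_three_nonzero {r : ℝ} (hr : 0 < r) {u v : Fin 4 → ℝ}
    (h : ∀ i, (u i = 0 ∧ v i = r) ∨ (u i = r ∧ v i = 0)) (hodd : ∏ i, (u i - v i) < 0) :
    ∃ l, (∀ i, u i = if i = l then 0 else r) ∨ ∀ i, v i = if i = l then 0 else r := by
  rw [Fin.prod_univ_four] at hodd
  have h4 : 0 < r * r * r * r := by positivity
  rcases h 0 with ⟨a0, b0⟩ | ⟨a0, b0⟩ <;> rcases h 1 with ⟨a1, b1⟩ | ⟨a1, b1⟩ <;>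
  rcases h 2 with ⟨a2, b2⟩ | ⟨a2, b2⟩ <;> rcases h 3 with ⟨a3, b3⟩ | ⟨a3, b3⟩ <;>
  first
  | exact absurd hodd (not_lt.2 (by rw [a0, a1, a2, a3, b0, b1, b2, b3]; linarith))
  | (refine ⟨0, Or.inl fun i => ?_⟩; fin_cases i <;> simp [a0, a1, a2, a3]; done)
  | (refine ⟨1, Or.inl fun i => ?_⟩; fin_cases i <;> simp [a0, a1, a2, a3]; done)
  | (refine ⟨2, Or.inl fun i => ?_⟩; fin_cases i <;> simp [a0, a1, a2, a3]; done)
  | (refine ⟨3, Or.inl fun i => ?_⟩; fin_cases i <;> simp [a0, a1, a2, a3]; done)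
  | (refine ⟨0, Or.inr fun i => ?_⟩; fin_cases i <;> simp [b0, b1, b2, b3]; done)
  | (refine ⟨1, Or.inr fun i => ?_⟩; fin_cases i <;> simp [b0, b1, b2, b3]; done)
  | (refine ⟨2, Or.inr fun i => ?_⟩; fin_cases i <;> simp [b0, b1, b2, b3]; done)
  | (refine ⟨3, Or.inr fun i => ?_⟩; fin_cases i <;> simp [b0, b1, b2, b3])

/-! ### Comparison of `p`-norms on `ℝ⁴` -/

namespace PiLp

theorem norm_sq_le_sum_sq {p : ENNReal} [Fact (1 ≤ p)] (hp : 2 ≤ p)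
    (z : PiLp p (fun _ : Fin 4 => ℝ)) : ‖z‖ ^ 2 ≤ ∑ i, z i ^ 2 := by
  have hS : 0 ≤ ∑ i, z i ^ 2 := Finset.sum_nonneg fun i _ => sq_nonneg _
  have hle : ∀ i, z i ^ 2 ≤ ∑ i, z i ^ 2 := fun i =>
    Finset.single_le_sum (f := fun i => z i ^ 2) (fun i _ => sq_nonneg _) (Finset.mem_univ i)
  rcases eq_or_ne p ⊤ with rfl | htop
  · rw [← Real.le_sqrt (norm_nonneg _) hS, norm_eq_ciSup]
    exact ciSup_le fun i => Real.le_sqrt_of_sq_le (by simpa using hle i)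
  · have hq : 2 ≤ p.toReal := by simpa using ENNReal.toReal_mono htop hp
    have hq0 : 0 < p.toReal := by linarith
    rw [norm_eq_sum hq0, ← Real.rpow_natCast, ← Real.rpow_mul (by positivity)]
    have hterm : ∀ i, ‖z i‖ ^ p.toReal ≤ z i ^ 2 * (∑ i, z i ^ 2) ^ (p.toReal / 2 - 1) := by
      intro i
      have h1 : ‖z i‖ ^ p.toReal = (z i ^ 2) ^ (1 + (p.toReal / 2 - 1)) := by
        rw [Real.norm_eq_abs, ← sq_abs (z i), ← Real.rpow_natCast, ← Real.rpow_mul (abs_nonneg _)]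
        congr 1
        push_cast
        ring
      rw [h1, Real.rpow_add_of_nonneg (sq_nonneg _) zero_le_one (by linarith), Real.rpow_one]
      exact mul_le_mul_of_nonneg_left
        (Real.rpow_le_rpow (sq_nonneg _) (hle i) (by linarith)) (sq_nonneg _)
    have hsum : ∑ i, ‖z i‖ ^ p.toReal ≤ (∑ i, z i ^ 2) ^ (p.toReal / 2) := by
      refine (Finset.sum_le_sum fun i _ => hterm i).trans_eq ?_
      rw [← Finset.sum_mul]
      nth_rw 1 [← Real.rpow_one (∑ i, z i ^ 2)]
      rw [← Real.rpow_add_of_nonneg hS zero_le_one (by linarith)]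
      congr 1
      ring
    refine (Real.rpow_le_rpow (by positivity) hsum (by positivity)).trans_eq ?_
    rw [← Real.rpow_mul hS]
    have : p.toReal / 2 * (1 / p.toReal * ((2 : ℕ) : ℝ)) = 1 := by
      push_cast
      field_simp
    rw [this, Real.rpow_one]

/-- For `p ≠ 2`, opposite vertices of a cube of side `r` are not at `p`-distance `2 r`. -/
theorem eq_two_of_norm_eq {p : ENNReal} [Fact (1 ≤ p)] {r : ℝ} (hr : 0 < r)
    (z : PiLp p (fun _ : Fin 4 => ℝ)) (hz : ∀ i, |z i| = r) (hn : ‖z‖ = 2 * r) : p = 2 := by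
  rcases eq_or_ne p ⊤ with rfl | htop
  · rw [norm_eq_ciSup] at hn
    simp only [Real.norm_eq_abs, hz, ciSup_const] at hn
    linarith
  · have hq0 : 0 < p.toReal := ENNReal.toReal_pos (one_pos.trans_le Fact.out).ne' htop
    rw [norm_eq_sum hq0] at hn
    simp only [Real.norm_eq_abs, hz, Finset.sum_const, Finset.card_univ, Fintype.card_fin,
      nsmul_eq_mul] at hn
    rw [Real.mul_rpow (by positivity) (by positivity), ← Real.rpow_mul hr.le,
      mul_one_div_cancel hq0.ne', Real.rpow_one] at hn
    have h2 : (4 : ℝ) ^ (1 / p.toReal) = 4 ^ (1 / 2 : ℝ) := by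
      rw [← Real.sqrt_eq_rpow, show (4 : ℝ) = 2 ^ 2 by norm_num, Real.sqrt_sq zero_le_two]
      have := mul_right_cancel₀ hr.ne' hn
      norm_num at this ⊢
      exact this
    have h3 := (Real.rpow_right_inj (by norm_num) (by norm_num)).1 h2
    have h4 : p.toReal = 2 := by
      field_simp at h3
      linarith
    rw [← ENNReal.ofReal_toReal htop, h4]
    simp

/-- Comparison of the power means with exponents `1` and `p`. -/
theorem sum_abs_le {p : ENNReal} [Fact (1 ≤ p)] (htop : p ≠ ⊤)
    (z : PiLp p (fun _ : Fin 4 => ℝ)) :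
    (4 : ℝ) ^ (1 / p.toReal - 1) * ∑ i, |z i| ≤ ‖z‖ := by
  have hq : 1 ≤ p.toReal := by simpa using ENNReal.toReal_mono htop (Fact.out : 1 ≤ p)
  have hq0 : 0 < p.toReal := by linarith
  have h := Real.rpow_sum_le_const_mul_sum_rpow Finset.univ (fun i => z i) hq
  have h' := Real.rpow_le_rpow (by positivity) h (one_div_nonneg.2 hq0.le)
  rw [← Real.rpow_mul (by positivity), mul_one_div_cancel hq0.ne', Real.rpow_one,
    Real.mul_rpow (by positivity) (by positivity), ← Real.rpow_mul (by positivity)] at h'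
  rw [norm_eq_sum hq0]
  simp only [Finset.card_univ, Fintype.card_fin, Nat.cast_ofNat] at h'
  refine (mul_le_mul_of_nonneg_left h' (by positivity)).trans_eq ?_
  rw [← mul_assoc, ← Real.rpow_add (by norm_num)]
  have : 1 / p.toReal - 1 + (p.toReal - 1) * (1 / p.toReal) = 0 := by
    field_simp
    ring
  rw [this, Real.rpow_zero, one_mul]
  simp only [Real.norm_eq_abs]

/-- Comparison of the power means with exponents `p` and `2`. -/
theorem norm_sq_le_mul_sum_sq {p : ENNReal} [Fact (1 ≤ p)] (hp : p ≤ 2)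
    (z : PiLp p (fun _ : Fin 4 => ℝ)) :
    ‖z‖ ^ 2 ≤ 4 * ((4 : ℝ) ^ (1 / p.toReal - 1)) ^ 2 * ∑ i, z i ^ 2 := by
  have htop : p ≠ ⊤ := ne_top_of_le_ne_top ENNReal.ofNat_ne_top hp
  have hq : 1 ≤ p.toReal := by simpa using ENNReal.toReal_mono htop (Fact.out : 1 ≤ p)
  have hq2 : p.toReal ≤ 2 := by simpa using ENNReal.toReal_mono ENNReal.ofNat_ne_top hp
  have hq0 : 0 < p.toReal := by linarith
  have h := Real.rpow_arith_mean_le_arith_mean_rpow Finset.univ (fun _ : Fin 4 => (1 / 4 : ℝ))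
    (fun i => ‖z i‖ ^ p.toReal) (fun _ _ => by norm_num) (by norm_num)
    (fun _ _ => by positivity) ((one_le_div hq0).2 hq2)
  have e : ∀ i, (‖z i‖ ^ p.toReal) ^ (2 / p.toReal) = z i ^ 2 := fun i => by
    rw [← Real.rpow_mul (norm_nonneg _), mul_div_cancel₀ _ hq0.ne', Real.rpow_two, Real.norm_eq_abs,
      sq_abs]
  simp only [e, ← Finset.mul_sum] at h
  rw [Real.mul_rpow (by positivity) (by positivity)] at h
  have hn : ‖z‖ ^ 2 = (∑ i, ‖z i‖ ^ p.toReal) ^ (2 / p.toReal) := by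
    rw [norm_eq_sum hq0, ← Real.rpow_natCast, ← Real.rpow_mul (by positivity)]
    congr 1
    push_cast
    ring
  rw [← hn] at h
  have h4 : (4 : ℝ) * ((4 : ℝ) ^ (1 / p.toReal - 1)) ^ 2 = 4 ^ (2 / p.toReal) * (1 / 4) := by
    rw [← Real.rpow_natCast, ← Real.rpow_mul (by norm_num),
      show (1 / 4 : ℝ) = 4 ^ (-1 : ℝ) by rw [Real.rpow_neg_one]; norm_num,
      ← Real.rpow_add (by norm_num)]
    nth_rw 1 [← Real.rpow_one 4]
    rw [← Real.rpow_add (by norm_num)]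
    congr 1
    push_cast
    ring
  have h5 : (4 : ℝ) ^ (2 / p.toReal) * (1 / 4) ^ (2 / p.toReal) = 1 := by
    rw [← Real.mul_rpow (by norm_num) (by norm_num)]
    norm_num
  calc ‖z‖ ^ 2 = 4 ^ (2 / p.toReal) * ((1 / 4) ^ (2 / p.toReal) * ‖z‖ ^ 2) := by
        rw [← mul_assoc, h5, one_mul]
    _ ≤ 4 ^ (2 / p.toReal) * (1 / 4 * ∑ i, z i ^ 2) := mul_le_mul_of_nonneg_left h (by positivity)
    _ = _ := by rw [h4, mul_assoc]

theorem norm_le_sum_abs {p : ENNReal} [Fact (1 ≤ p)] {ι : Type*} [Fintype ι]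
    (z : PiLp p (fun _ : ι => ℝ)) : ‖z‖ ≤ ∑ i, |z i| := by
  classical
  have hz : z = ∑ i, PiLp.single p i (z i) := by
    ext j
    simp [Finset.sum_apply, Pi.single_apply]
  conv_lhs => rw [hz]
  refine (norm_sum_le _ _).trans_eq (Finset.sum_congr rfl fun i _ => ?_)
  simp

end PiLp

/-! ### Hadamard coordinates -/

/-- The coordinates of `z` along the rows of the `4 × 4` Hadamard matrix, scaled by `k`. -/
def hadamardCoord (k : ℝ) (z : Fin 4 → ℝ) : Fin 4 → ℝ :=
  ![k * (z 0 + z 1 + z 2 + z 3), k * (z 0 + z 1 - z 2 - z 3),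
    k * (z 0 - z 1 + z 2 - z 3), k * (z 0 - z 1 - z 2 + z 3)]

theorem hadamardCoord_sub (k : ℝ) (z w : Fin 4 → ℝ) (i : Fin 4) :
    hadamardCoord k z i - hadamardCoord k w i = hadamardCoord k (fun j => z j - w j) i := by
  fin_cases i <;> simp [hadamardCoord] <;> ring

theorem continuous_hadamardCoord (k : ℝ) (i : Fin 4) :
    Continuous fun z : Fin 4 → ℝ => hadamardCoord k z i := by
  fin_cases i <;> simp [hadamardCoord] <;> fun_prop

theorem sum_hadamardCoord_sq (k : ℝ) (z : Fin 4 → ℝ) :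
    ∑ i, hadamardCoord k z i ^ 2 = 4 * k ^ 2 * ∑ i, z i ^ 2 := by
  simp [hadamardCoord, Fin.sum_univ_four]
  ring

theorem abs_hadamardCoord_le {k : ℝ} (hk : 0 ≤ k) (z : Fin 4 → ℝ) (i : Fin 4) :
    |hadamardCoord k z i| ≤ k * ∑ j, |z j| := by
  rw [Fin.sum_univ_four]
  fin_cases i <;> simp only [hadamardCoord, Fin.zero_eta, Fin.mk_one, Fin.reduceFinMk,
      Matrix.cons_val] <;> rw [abs_mul, abs_of_nonneg hk] <;>
    refine mul_le_mul_of_nonneg_left (abs_le.2 ⟨?_, ?_⟩) hk <;>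
    linarith [neg_abs_le (z 0), neg_abs_le (z 1), neg_abs_le (z 2), neg_abs_le (z 3),
      le_abs_self (z 0), le_abs_self (z 1), le_abs_self (z 2), le_abs_self (z 3)]

/-- Reversing one sign in the sum of all Hadamard coordinates gives, up to signs of the `z j`,
twice the coordinate sum: the sign vectors with one negative entry are, up to the factor `2`,
mapped to sign vectors by the Hadamard matrix. -/
theorem abs_sum_hadamardCoord_le {k : ℝ} (hk : 0 ≤ k) (z : Fin 4 → ℝ) (l : Fin 4) :
    |∑ i, (if i = l then -1 else 1) * hadamardCoord k z i| ≤ 2 * (k * ∑ j, |z j|) := by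
  have key : ∀ s : ℝ, |s| ≤ ∑ j, |z j| → |2 * k * s| ≤ 2 * (k * ∑ j, |z j|) := fun s hs => by
    rw [abs_mul, abs_of_nonneg (by positivity : 0 ≤ 2 * k), mul_assoc]
    gcongr
  have bound : ∀ s, s ≤ ∑ j, |z j| → -s ≤ ∑ j, |z j| → |s| ≤ ∑ j, |z j| := fun s h1 h2 =>
    abs_le'.2 ⟨h1, h2⟩
  have h0 := abs_le.1 (le_refl |z 0|)
  have h1 := abs_le.1 (le_refl |z 1|)
  have h2 := abs_le.1 (le_refl |z 2|)
  have h3 := abs_le.1 (le_refl |z 3|)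
  have hS := Fin.sum_univ_four fun j => |z j|
  obtain rfl | rfl | rfl | rfl : l = 0 ∨ l = 1 ∨ l = 2 ∨ l = 3 := by fin_cases l <;> simp
  · convert key (z 0 - z 1 - z 2 - z 3) (bound _ (by linarith) (by linarith)) using 2
    simp [Fin.sum_univ_four, hadamardCoord]
    ring
  · convert key (z 0 - z 1 + z 2 + z 3) (bound _ (by linarith) (by linarith)) using 2
    simp [Fin.sum_univ_four, hadamardCoord]
    ring
  · convert key (z 0 + z 1 - z 2 + z 3) (bound _ (by linarith) (by linarith)) using 2
    simp [Fin.sum_univ_four, hadamardCoord]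
    ring
  · convert key (z 0 + z 1 + z 2 - z 3) (bound _ (by linarith) (by linarith)) using 2
    simp [Fin.sum_univ_four, hadamardCoord]
    ring

/-- A vector whose Hadamard coordinates are `± r` with an even number of negative signs is a
multiple of a standard basis vector, so its `ℓ¹` norm is a single coordinate, `r / k`. -/
theorem mul_sum_abs_eq_of_prod_pos {k r : ℝ} (hk : 0 < k) (hr : 0 < r) (z : Fin 4 → ℝ)
    (hz : ∀ i, |hadamardCoord k z i| = r) (hpos : 0 < ∏ i, hadamardCoord k z i) :
    k * ∑ j, |z j| = r := by
  have e0 : 4 * (k * z 0) = hadamardCoord k z 0 + hadamardCoord k z 1 + hadamardCoord k z 2 +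
      hadamardCoord k z 3 := by simp [hadamardCoord]; ring
  have e1 : 4 * (k * z 1) = hadamardCoord k z 0 + hadamardCoord k z 1 - hadamardCoord k z 2 -
      hadamardCoord k z 3 := by simp [hadamardCoord]; ring
  have e2 : 4 * (k * z 2) = hadamardCoord k z 0 - hadamardCoord k z 1 + hadamardCoord k z 2 -
      hadamardCoord k z 3 := by simp [hadamardCoord]; ring
  have e3 : 4 * (k * z 3) = hadamardCoord k z 0 - hadamardCoord k z 1 - hadamardCoord k z 2 +
      hadamardCoord k z 3 := by simp [hadamardCoord]; ring
  rw [Fin.prod_univ_four] at hpos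
  have h4 : 0 < r * r * r * r := by positivity
  have habs : k * ∑ j, |z j| = |k * z 0| + |k * z 1| + |k * z 2| + |k * z 3| := by
    simp only [abs_mul, abs_of_pos hk, Fin.sum_univ_four]
    ring
  rw [habs]
  rcases (abs_eq hr.le).1 (hz 0) with a0 | a0 <;> rcases (abs_eq hr.le).1 (hz 1) with a1 | a1 <;>
  rcases (abs_eq hr.le).1 (hz 2) with a2 | a2 <;> rcases (abs_eq hr.le).1 (hz 3) with a3 | a3 <;>
  rw [a0, a1, a2, a3] at e0 e1 e2 e3 hpos <;>
  first
  | (exfalso; linarith)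
  | (rw [show k * z 0 = 0 by linarith, show k * z 1 = 0 by linarith,
      show k * z 2 = 0 by linarith]
     rcases abs_cases (k * z 3) with h | h <;> rw [abs_zero] <;> linarith)
  | (rw [show k * z 0 = 0 by linarith, show k * z 1 = 0 by linarith,
      show k * z 3 = 0 by linarith]
     rcases abs_cases (k * z 2) with h | h <;> rw [abs_zero] <;> linarith)
  | (rw [show k * z 0 = 0 by linarith, show k * z 2 = 0 by linarith,
      show k * z 3 = 0 by linarith]
     rcases abs_cases (k * z 1) with h | h <;> rw [abs_zero] <;> linarith)
  | (rw [show k * z 1 = 0 by linarith, show k * z 2 = 0 by linarith,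
      show k * z 3 = 0 by linarith]
     rcases abs_cases (k * z 0) with h | h <;> rw [abs_zero] <;> linarith)

/-! ### Division of compact sets into sixteen pieces -/

theorem dividesInto_of_two_le {p : ENNReal} [Fact (1 ≤ p)] (hp : 2 ≤ p)
    {X : Set (PiLp p (fun _ : Fin 4 => ℝ))} (hX : IsCompact X) (hne : X.Nonempty) {r : ℝ}
    (hr : 0 < r) (hd : Metric.diam X = 2 * r) : DividesInto X 16 := by
  by_contra h16
  have hsub : ∀ (x y : PiLp p (fun _ : Fin 4 => ℝ)) i, x i - y i = (x - y) i := fun _ _ _ => rfl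
  obtain ⟨c, hc⟩ := exists_opposite_vertices hX hne hr hd (fun i x => x i)
    (fun i => by fun_prop)
    (fun i x y => by rw [hsub, dist_eq_norm, ← Real.norm_eq_abs]; exact PiLp.norm_apply_le _ i)
    (fun x y => by rw [dist_eq_norm]; exact PiLp.norm_sq_le_sum_sq hp (x - y)) h16
  obtain ⟨x, hx, y, hy, hxy, hv⟩ := hc (fun _ => 1) fun _ => Or.inl rfl
  obtain ⟨x', hx', y', hy', -, hv'⟩ := hc (fun _ => -1) fun _ => Or.inr rfl
  simp only [one_mul, neg_one_mul] at hv hv'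
  have hp2 : p = 2 := by
    refine PiLp.eq_two_of_norm_eq hr (x - y) (fun i => ?_) (by rw [← dist_eq_norm, hxy])
    rw [← hsub, ← sub_sub_sub_cancel_right _ _ (c i)]
    rcases hv i with ⟨h1, h2⟩ | ⟨h1, h2⟩ <;> simp [h1, h2, abs_of_pos hr]
  subst hp2
  refine false_of_opposite_orthants (L := fun i (x : PiLp 2 (fun _ : Fin 4 => ℝ)) => x i) hr
    (fun a ha b hb => hd ▸ Metric.dist_le_diam_of_mem hX.isBounded ha hb)
    (fun a b => ?_) hx hy hx' hy' hv hv'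
  rw [PiLp.dist_eq_of_L2, Real.sq_sqrt (by positivity)]
  simp [Real.dist_eq, sq_abs]

theorem dividesInto_of_lt_two {p : ENNReal} [Fact (1 ≤ p)] (hp : p < 2)
    {X : Set (PiLp p (fun _ : Fin 4 => ℝ))} (hX : IsCompact X) (hne : X.Nonempty) {r : ℝ}
    (hr : 0 < r) (hd : Metric.diam X = 2 * r) : DividesInto X 16 := by
  by_contra h16
  have htop : p ≠ ⊤ := (hp.trans ENNReal.ofNat_lt_top).ne
  have hq1 : 1 ≤ p.toReal := by simpa using ENNReal.toReal_mono htop (Fact.out : 1 ≤ p)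
  have hq2 : p.toReal < 2 := by
    simpa using (ENNReal.toReal_lt_toReal htop ENNReal.ofNat_ne_top).2 hp
  set k : ℝ := 4 ^ (1 / p.toReal - 1)
  have hk0 : 0 < k := by positivity
  have hkhalf : 1 / 2 < k := by
    have h1 : (1 / 2 : ℝ) = 4 ^ (-(1 / 2) : ℝ) := by
      rw [Real.rpow_neg (by norm_num), ← Real.sqrt_eq_rpow, show (4 : ℝ) = 2 ^ 2 by norm_num,
        Real.sqrt_sq zero_le_two]
      norm_num
    rw [h1]
    refine Real.rpow_lt_rpow_of_exponent_lt (by norm_num) ?_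
    have : 1 / 2 < 1 / p.toReal := one_div_lt_one_div_of_lt (by linarith) hq2
    linarith
  have hsub : ∀ (x y : PiLp p (fun _ : Fin 4 => ℝ)) i, hadamardCoord k x i - hadamardCoord k y i =
      hadamardCoord k (WithLp.ofLp (x - y)) i := fun x y i => hadamardCoord_sub k x y i
  obtain ⟨c, hc⟩ := exists_opposite_vertices hX hne hr hd
    (fun i x => hadamardCoord k x i)
    (fun i => (continuous_hadamardCoord k i).comp (PiLp.continuous_ofLp p _))
    (fun i x y => by
      rw [hsub, dist_eq_norm]
      exact (abs_hadamardCoord_le hk0.le _ i).trans (PiLp.sum_abs_le htop (_ - _)))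
    (fun x y => by
      simp only [hsub, dist_eq_norm, sum_hadamardCoord_sq]
      exact PiLp.norm_sq_le_mul_sum_sq hp.le _) h16
  obtain ⟨x, hx, y, hy, hxy, hv⟩ := hc (fun _ => 1) fun _ => Or.inl rfl
  simp only [one_mul] at hv
  have hcoord : ∀ i, |hadamardCoord k (WithLp.ofLp (x - y)) i| = r := fun i => by
    rw [← hsub, ← sub_sub_sub_cancel_right _ _ (c i)]
    rcases hv i with ⟨h1, h2⟩ | ⟨h1, h2⟩ <;> simp [h1, h2, abs_of_pos hr]
  -- An even sign pattern would make the distance of `x` and `y` at most `r / k < 2 r`.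
  have hodd : ∏ i, hadamardCoord k (WithLp.ofLp (x - y)) i < 0 := by
    refine lt_of_le_of_ne (not_lt.1 fun hpos => ?_) ?_
    · have h1 := mul_sum_abs_eq_of_prod_pos hk0 hr _ hcoord hpos
      have h2 : 2 * r ≤ ∑ j, |(x - y) j| := by
        rw [← hxy, dist_eq_norm]
        exact PiLp.norm_le_sum_abs _
      nlinarith
    · refine Finset.prod_ne_zero_iff.2 fun i _ h0 => ?_
      have := hcoord i
      rw [h0, abs_zero] at this
      exact hr.ne this
  have hodd' : ∏ i, ((hadamardCoord k x i - c i) - (hadamardCoord k y i - c i)) < 0 := by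
    simpa only [sub_sub_sub_cancel_right, hsub] using hodd
  obtain ⟨l, hl⟩ := exists_three_nonzero hr hv hodd'
  obtain ⟨x', hx', y', hy', -, hv'⟩ := hc (fun i => if i = l then 1 else -1)
    fun i => by by_cases h : i = l <;> simp [h]
  have hbound : ∀ a ∈ X, ∀ b ∈ X, dist a b ≤ 2 * r :=
    fun a ha b hb => hd ▸ Metric.dist_le_diam_of_mem hX.isBounded ha hb
  have hfun : ∀ a b : PiLp p (fun _ : Fin 4 => ℝ),
      |∑ i, (if i = l then -1 else 1) * (hadamardCoord k a i - hadamardCoord k b i)| ≤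
        2 * dist a b := fun a b => by
    simp only [hsub, dist_eq_norm]
    exact (abs_sum_hadamardCoord_le hk0.le _ l).trans
      (mul_le_mul_of_nonneg_left (PiLp.sum_abs_le htop (_ - _)) zero_le_two)
  rcases hl with hl | hl
  · exact false_of_three_nonzero (L := fun i (x : PiLp p (fun _ : Fin 4 => ℝ)) =>
      hadamardCoord k x i) hr hbound l hfun hx hx' hy' hl hv'
  · exact false_of_three_nonzero (L := fun i (x : PiLp p (fun _ : Fin 4 => ℝ)) =>
      hadamardCoord k x i) hr hbound l hfun hy hx' hy' hl hv'

/-- `PiLp p (fun _ : Fin 4 => ℝ)` is `ℝ⁴` with the `p`-norm (the maximum norm for `p = ⊤`). -/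
theorem theorem1p1 (p : ENNReal) [Fact (1 ≤ p)] (X : Set (PiLp p (fun _ : Fin 4 => ℝ)))
    (hbounded : Bornology.IsBounded X) (htwo : X.Nontrivial) :
    borsukNumber X ≤ 2 ^ 4 := by
  have hX : IsCompact (closure X) := hbounded.isCompact_closure
  obtain ⟨x, hx, y, hy, hxy⟩ := htwo
  have hpos : 0 < Metric.diam (closure X) / 2 := by
    rw [Metric.diam_closure]
    exact half_pos ((dist_pos.2 hxy).trans_le (Metric.dist_le_diam_of_mem hbounded hx hy))
  have hne : (closure X).Nonempty := ⟨x, subset_closure hx⟩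
  have hdiv : DividesInto (closure X) 16 := by
    rcases le_or_gt 2 p with hp | hp
    · exact dividesInto_of_two_le hp hX hne hpos (by ring)
    · exact dividesInto_of_lt_two hp hX hne hpos (by ring)
  have h := (borsukNumber_le_iff X 16).2 ⟨16, le_rfl, hdiv.of_closure hbounded⟩
  exact_mod_cast h
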